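/- Let $N$ be a topological manifold of dimension $n\ge 0$ without boundary, i.e. a Hausdorff space (not necessarily second countable) locally homeomorphic to $\mathbb R^n$; in particular, $N$ may be any smooth manifold of dimension $n$. Let $r\ge 0$ be an integer, and let $$\Delta=\{(x_1,\dots,x_r)\in N^r : x_1=x_2=\cdots=x_r\}$$ be the thin diagonal. Then the inclusion $$N^r\setminus\Delta\longrightarrow N^r$$ is $((r-1)n-1)$-connected. Here, for an integer $k$, a space $X$ is called $k$-connected if it is nonempty whenever $k\ge -1$ and $\pi_i(X,x)$ is trivial for all $0\le i\le k$ and all basepoints $x\in X$ (so $(-1)$-connected means nonempty, and there is no condition for $k\le -2$). A map $f\colon X\to Y$ is called $k$-connected if for every $y\in Y$ the homotopy fiber of $f$ over $y$, that is, the space of pairs $(x,\gamma)$ with $x\in X$ and $\gamma$ a path in $Y$ from $f(x)$ to $y$, is $(k-1)$-connected. -/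

import Mathlib

open scoped unitInterval

/-- A topological space `X` is `k`-connected (`k` an integer): it is nonempty if `k ≥ -1`, and
`π_i(X, x)` is trivial for all `0 ≤ i ≤ k` and all basepoints `x`. In particular `(-1)`-connected
means nonempty, and for `k ≤ -2` there is no condition. -/
def IsKConnectedSpace (k : ℤ) (X : Type*) [TopologicalSpace X] : Prop :=
  (-1 ≤ k → Nonempty X) ∧
    ∀ i : ℕ, (i : ℤ) ≤ k → ∀ x : X, Subsingleton (HomotopyGroup.Pi i X x)

/-- The homotopy fiber of `f : X → Y` over `y`: pairs of a point `x` of `X` and a path in `Y`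
from `f x` to `y`, as a subspace of `X × C(I, Y)` with the compact-open topology on paths. -/
abbrev HomotopyFiber {X Y : Type*} [TopologicalSpace X] [TopologicalSpace Y]
    (f : C(X, Y)) (y : Y) : Type _ :=
  {p : X × C(I, Y) // p.2 0 = f p.1 ∧ p.2 1 = y}

/-- A map is `k`-connected if its homotopy fiber over every point of the target is
`(k - 1)`-connected. -/
def IsKConnectedMap (k : ℤ) {X Y : Type*} [TopologicalSpace X] [TopologicalSpace Y]
    (f : C(X, Y)) : Prop :=
  ∀ y : Y, IsKConnectedSpace (k - 1) (HomotopyFiber f y)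

/-- The thin diagonal of `N^r`: the tuples all of whose entries coincide. -/
def thinDiagonal (r : ℕ) (N : Type*) : Set (Fin r → N) :=
  {x | ∀ i j, x i = x j}

/-- The inclusion of the complement of the thin diagonal into `N^r`. -/
def thinDiagonalComplInclusion (r : ℕ) (N : Type*) [TopologicalSpace N] :
    C(((thinDiagonal r N)ᶜ : Set (Fin r → N)), Fin r → N) :=
  ⟨Subtype.val, continuous_subtype_val⟩

/-!
# Connectivity of the complement of the thin diagonal

For `r = 0` there is nothing to show. For `r = k + 1` the thin diagonal `A` is a closed subset of
`Y = N^(k+1)` which near each of its points is the zero set of a coordinate with values in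
`E = (ℝⁿ)ᵏ`, namely `y ↦ (φ(y₁) - φ(y₀), …, φ(y_k) - φ(y₀))` for a chart `φ` of `N`, and points of
`Y` can be moved so that this coordinate is translated by any small vector
(`hasTransverseCharts_thinDiagonal`). The theorem holds for every closed `A ⊆ Y` with such charts:
its complement includes by a `(dim E - 1)`-connected map
(`HasTransverseCharts.isKConnectedMap_compl_inclusion`).

The reason is general position. A map from a space of dimension less than `dim E` to `E` can be
approximated by a smooth map, whose image has dense complement; subtracting a small vector outside
the image makes it nowhere zero (`exists_nonvanishing_approx`). Hence a map `f : X → Y` from a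
compact space can be perturbed inside one chart, with a cutoff function, so as to avoid `A` on a
given part of a low-dimensional closed set `F ⊆ X` (`TransverseChart.exists_perturbation`).
Finitely many perturbations, each so small that it does not spoil the earlier ones, move `f` off
`A` on all of `F` without changing it on a closed set `C`, as long as `f` avoids `A` on `F ∩ C`
(`HasTransverseCharts.exists_avoiding`).

The homotopy fiber over `y` is the space of paths that end at `y` and start outside `A`. A cubical
loop in it is null-homotopic, relative to the boundary of the cube, in the contractible space of all
paths ending at `y` (`homotopicRel_const_of_pathsEndingAt`). Such a null-homotopy is a map
`(I × Iⁱ) × I → Y`, the last factor being the path parameter, and it is a null-homotopy in the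
homotopy fiber as soon as the face where the path parameter is `0` avoids `A`. This face has
dimension `i + 1`, so for `i + 1 < dim E` it can be pushed off `A` while the other faces, which
carry all the boundary conditions, stay fixed (`HasTransverseCharts.subsingleton_pi_homotopyFiber`).
-/

open Set Topology

/-! ### Transverse charts along a subset -/

/-- A chart of `Y` transverse to `A` with model space `E`: on the open set `source` there is a
coordinate with values in `E`, and `shift (y, w)` moves a point `y` so that its coordinate changes
by `w`; this is defined for `(y, w)` in a neighborhood `domain` of `source × {0}`. In particular
(`w = 0`) the points of `A` in `source` are those with coordinate zero. -/
structure TransverseChart {Y : Type*} [TopologicalSpace Y] (A : Set Y) (E : Type*)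
    [TopologicalSpace E] [AddCommGroup E] where
  source : Set Y
  isOpen_source : IsOpen source
  coord : Y → E
  continuousOn_coord : ContinuousOn coord source
  domain : Set (Y × E)
  isOpen_domain : IsOpen domain
  zero_mem_domain : ∀ y ∈ source, (y, 0) ∈ domain
  shift : Y × E → Y
  continuousOn_shift : ContinuousOn shift domain
  shift_zero : ∀ y ∈ source, shift (y, 0) = y
  shift_mem_iff : ∀ p ∈ domain, shift p ∈ A ↔ coord p.1 + p.2 = 0

/-- Every point of `A` lies in the source of a chart transverse to `A` with model space `E`; thus
`A` is locally the zero set of a coordinate which can be translated freely by small vectors of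
`E`. -/
def HasTransverseCharts {Y : Type*} [TopologicalSpace Y] (A : Set Y) (E : Type*)
    [TopologicalSpace E] [AddCommGroup E] : Prop :=
  ∀ a ∈ A, ∃ c : TransverseChart A E, a ∈ c.source

theorem isClosed_thinDiagonal (r : ℕ) (N : Type*) [TopologicalSpace N] [T2Space N] :
    IsClosed (thinDiagonal r N) := by
  simp only [thinDiagonal, ofPred_forall]
  exact isClosed_iInter fun i => isClosed_iInter fun j =>
    isClosed_eq (continuous_apply i) (continuous_apply j)

/-- The transverse chart of the thin diagonal of `N^(k+1)` on the tuples with entries in the source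
of a chart `φ` of `N`. The coordinate compares the last `k` entries with the first one in the chart,
and a shift moves the last `k` entries while it keeps the first. -/
def thinDiagonalTransverseChart {V N : Type*} [NormedAddCommGroup V] [TopologicalSpace N]
    (k : ℕ) (φ : OpenPartialHomeomorph N V) :
    TransverseChart (thinDiagonal (k + 1) N) (Fin k → V) where
  source := {y | ∀ j, y j ∈ φ.source}
  isOpen_source := by
    simp only [ofPred_forall]
    exact isOpen_iInter_of_finite fun j => φ.open_source.preimage (continuous_apply j)
  coord y j := φ (y j.succ) - φ (y 0)
  continuousOn_coord := by
    refine continuousOn_pi.2 fun j => ContinuousOn.sub ?_ ?_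
    · exact φ.continuousOn.comp (continuous_apply _).continuousOn fun y hy => hy _
    · exact φ.continuousOn.comp (continuous_apply _).continuousOn fun y hy => hy _
  domain := {p | ∀ j, p.1 j ∈ φ.source} ∩ ⋂ j : Fin k,
    ({p : (Fin (k + 1) → N) × (Fin k → V) | p.1 j.succ ∈ φ.source} ∩
      (fun p => φ (p.1 j.succ) + p.2 j) ⁻¹' φ.target)
  isOpen_domain := by
    refine IsOpen.inter ?_ (isOpen_iInter_of_finite fun j => ?_)
    · simp only [ofPred_forall]
      exact isOpen_iInter_of_finite fun j => φ.open_source.preimage (by fun_prop)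
    · refine ContinuousOn.isOpen_inter_preimage (ContinuousOn.add ?_ (by fun_prop))
        (φ.open_source.preimage (by fun_prop)) φ.open_target
      exact φ.continuousOn.comp (t := φ.source) (by fun_prop) fun p hp => hp
  zero_mem_domain y hy := ⟨hy, mem_iInter.2 fun j =>
    ⟨hy _, by simpa using φ.map_source (hy j.succ)⟩⟩
  shift p := Fin.cons (p.1 0) fun j => φ.symm (φ (p.1 j.succ) + p.2 j)
  continuousOn_shift := by
    refine continuousOn_pi.2 fun i => ?_
    refine Fin.cases ?_ (fun j => ?_) i
    · simp only [Fin.cons_zero]; fun_prop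
    · simp only [Fin.cons_succ]
      refine φ.continuousOn_symm.comp (t := φ.target) (ContinuousOn.add ?_ (by fun_prop))
        fun p hp => (mem_iInter.1 hp.2 j).2
      exact φ.continuousOn.comp (t := φ.source) (by fun_prop) fun p hp => hp.1 _
  shift_zero y hy := by
    funext i
    refine Fin.cases ?_ (fun j => ?_) i
    · simp
    · simpa using φ.left_inv (hy j.succ)
  shift_mem_iff := by
    rintro ⟨y, w⟩ ⟨hy, hw⟩
    have key : ∀ j : Fin k, φ.symm (φ (y j.succ) + w j) = y 0 ↔
        φ (y j.succ) - φ (y 0) + w j = 0 := fun j => by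
      have hj : φ (y j.succ) + w j ∈ φ.target := (mem_iInter.1 hw j).2
      rw [sub_add_eq_add_sub, sub_eq_zero]
      exact ⟨fun h => by rw [← h, φ.right_inv hj], fun h => by rw [h, φ.left_inv (hy 0)]⟩
    constructor
    · intro h
      funext j
      exact (key j).1 (by simpa using h j.succ 0)
    · intro h
      have h0 : ∀ i, (Fin.cons (y 0) fun j => φ.symm (φ (y j.succ) + w j) :
          Fin (k + 1) → N) i = y 0 := by
        refine fun i => Fin.cases rfl (fun j => ?_) i
        rw [Fin.cons_succ, key j]
        exact congrFun h j
      exact fun i j => (h0 i).trans (h0 j).symm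

theorem hasTransverseCharts_thinDiagonal (k : ℕ) (V N : Type*) [NormedAddCommGroup V]
    [TopologicalSpace N] [ChartedSpace V N] :
    HasTransverseCharts (thinDiagonal (k + 1) N) (Fin k → V) := fun a ha =>
  ⟨thinDiagonalTransverseChart k (chartAt V (a 0)), fun j => by
    rw [ha j 0]; exact mem_chart_source V (a 0)⟩

/-! ### Pushing a map off a subset -/

section GeneralPosition

variable {X Y E : Type*} [TopologicalSpace X] [CompactSpace X] [T2Space X] [TopologicalSpace Y]
  [NormedAddCommGroup E] [NormedSpace ℝ E] {A : Set Y}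

/-- Every continuous map `X → E` can be uniformly approximated by maps without zeros on `F`. For
finite-dimensional `E` this expresses that the dimension of `F` is less than that of `E`. -/
def NonvanishingDenseOn (F : Set X) (E : Type*) [NormedAddCommGroup E] : Prop :=
  ∀ (g : C(X, E)) (ε : ℝ), 0 < ε → ∃ h : C(X, E), (∀ x, ‖h x - g x‖ < ε) ∧ ∀ x ∈ F, h x ≠ 0

/-- A map `f` can be perturbed within one transverse chart so as to avoid `A` on `K ∩ F`. The open
neighborhood `O` of the graph of `f` prescribes how small the perturbation has to be. -/
theorem TransverseChart.exists_perturbation [FiniteDimensional ℝ E] (c : TransverseChart A E)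
    {F C K : Set X} (hF : NonvanishingDenseOn F E) (hC : IsClosed C) (hK : IsClosed K)
    (hKC : Disjoint K C) (f : C(X, Y)) (hfK : MapsTo f K c.source) {O : Set (X × Y)}
    (hO : IsOpen O) (hfO : ∀ x, (x, f x) ∈ O) :
    ∃ f' : C(X, Y), (∀ x, (x, f' x) ∈ O) ∧ EqOn f' f C ∧ ∀ x ∈ K, x ∈ F → f' x ∉ A := by
  -- The perturbation takes place in `L`, and `b` is its cutoff function.
  obtain ⟨L, hL, hKL, hLU⟩ := exists_compact_between hK.isCompact
    ((c.isOpen_source.preimage f.continuous).inter hC.isOpen_compl)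
    fun x hx => ⟨hfK hx, disjoint_left.1 hKC hx⟩
  obtain ⟨b, hb0, hb1, hb⟩ := exists_continuous_zero_one_of_isClosed
    (s := (interior L)ᶜ) (t := K) isOpen_interior.isClosed_compl hK
    (disjoint_left.2 fun x hx hx' => hx (hKL hx'))
  have hqf : ContinuousOn (fun x => c.coord (f x)) L :=
    c.continuousOn_coord.comp f.continuous.continuousOn fun x hx => (hLU hx).1
  have : TietzeExtension E := TietzeExtension.of_tvs ℝ
  obtain ⟨g, hg⟩ := ContinuousMap.exists_restrict_eq hL.isClosed ⟨_, hqf.domRestrict⟩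
  have hg' : ∀ x ∈ L, g x = c.coord (f x) := fun x hx => DFunLike.congr_fun hg ⟨x, hx⟩
  -- By compactness of `L`, shifts by vectors of norm less than a suitable `ε` stay in `O`.
  have hS1 : IsOpen {p : X × E | (f p.1, p.2) ∈ c.domain} :=
    c.isOpen_domain.preimage (by fun_prop)
  have hS : IsOpen ({p : X × E | (f p.1, p.2) ∈ c.domain} ∩
      (fun p => (p.1, c.shift (f p.1, p.2))) ⁻¹' O) := by
    refine ContinuousOn.isOpen_inter_preimage (ContinuousOn.prodMk (by fun_prop) ?_) hS1 hO
    exact c.continuousOn_shift.comp (by fun_prop) fun p hp => hp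
  obtain ⟨u, v, -, hv, hLu, h0v, huv⟩ := generalized_tube_lemma hL
    (isCompact_singleton (x := (0 : E))) hS (by
      rintro ⟨x, w⟩ ⟨hx, rfl : w = 0⟩
      refine ⟨c.zero_mem_domain _ (hLU hx).1, ?_⟩
      simpa [c.shift_zero _ (hLU hx).1] using hfO x)
  obtain ⟨ε, hε, hεv⟩ := Metric.isOpen_iff.1 hv 0 (h0v rfl)
  -- On `K`, where `b = 1`, shifting by `h - g` turns the coordinate `g` into `h`.
  obtain ⟨h, hhg, hhF⟩ := hF g ε hε
  have hw : ∀ x, b x • (h x - g x) ∈ v := fun x => hεv <| by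
    rw [mem_ball_zero_iff, norm_smul, Real.norm_of_nonneg (hb x).1]
    exact (mul_le_of_le_one_left (norm_nonneg _) (hb x).2).trans_lt (hhg x)
  have hmem : ∀ x ∈ L, _ := fun x hx => huv (mk_mem_prod (hLu hx) (hw x))
  classical
  let f₁ : X → Y := fun x => if x ∈ L then c.shift (f x, b x • (h x - g x)) else f x
  have hf₁L : EqOn f₁ (fun x => c.shift (f x, b x • (h x - g x))) L := fun x hx => if_pos hx
  have hf₁ : EqOn f₁ f (interior L)ᶜ := fun x hx => by
    by_cases hxL : x ∈ L
    · simp only [f₁, if_pos hxL, hb0 hx, Pi.zero_apply, zero_smul]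
      exact c.shift_zero _ (hLU hxL).1
    · exact if_neg hxL
  have hcont : Continuous f₁ := by
    have h1 : ContinuousOn f₁ L := by
      refine ContinuousOn.congr ?_ hf₁L
      exact c.continuousOn_shift.comp (by fun_prop) fun x hx => (hmem x hx).1
    have h2 : ContinuousOn f₁ (interior L)ᶜ := f.continuous.continuousOn.congr hf₁
    have := h1.union_of_isClosed h2 hL.isClosed isOpen_interior.isClosed_compl
    rwa [show L ∪ (interior L)ᶜ = univ from
      eq_univ_of_forall fun x => (em (x ∈ L)).imp id fun hx hx' => hx (interior_subset hx'),
      continuousOn_univ] at this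
  refine ⟨⟨f₁, hcont⟩, fun x => ?_, fun x hx => ?_, fun x hx hxF => ?_⟩
  · by_cases hxL : x ∈ L
    · simpa [f₁, hxL] using (hmem x hxL).2
    · simpa [f₁, hxL] using hfO x
  · exact if_neg fun hxL => (hLU hxL).2 hx
  · have hxL : x ∈ L := interior_subset (hKL hx)
    change f₁ x ∉ A
    rw [hf₁L hxL, c.shift_mem_iff _ (hmem x hxL).1]
    simpa [hb1 hx, hg' x hxL] using hhF x hxF

/-- General position: a map that avoids `A` on `F ∩ C` can be changed outside `C` so as to avoid `A`
on all of `F`, if the dimension of `F` is less than that of `E`. -/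
theorem HasTransverseCharts.exists_avoiding [FiniteDimensional ℝ E]
    (hA : HasTransverseCharts A E) (hAc : IsClosed A) {F C : Set X}
    (hF : NonvanishingDenseOn F E) (hFc : IsClosed F) (hC : IsClosed C) (f : C(X, Y))
    (hf : ∀ x ∈ F, x ∈ C → f x ∉ A) :
    ∃ f' : C(X, Y), EqOn f' f C ∧ ∀ x ∈ F, f' x ∉ A := by
  have hD : IsCompact (F ∩ f ⁻¹' A) := (hFc.inter (hAc.preimage f.continuous)).isCompact
  have hloc : ∀ x : ↥(F ∩ f ⁻¹' A), ∃ (K : Set X) (c : TransverseChart A E),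
      x.1 ∈ interior K ∧ IsClosed K ∧ MapsTo f K c.source ∧ Disjoint K C := by
    rintro ⟨x, hxF, hxA⟩
    obtain ⟨c, hc⟩ := hA _ hxA
    obtain ⟨K, hK, hxK, hKU⟩ := exists_compact_subset
      ((c.isOpen_source.preimage f.continuous).inter hC.isOpen_compl)
      (show x ∈ f ⁻¹' c.source ∩ Cᶜ from ⟨hc, fun hxC => hf x hxF hxC hxA⟩)
    exact ⟨K, c, hxK, hK.isClosed, fun y hy => (hKU hy).1, disjoint_left.2 fun y hy => (hKU hy).2⟩
  choose K c hxK hK hfK hKC using hloc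
  obtain ⟨t, ht⟩ := hD.elim_finite_subcover (fun x => interior (K x)) (fun _ => isOpen_interior)
    fun x hx => mem_iUnion.2 ⟨⟨x, hx⟩, hxK _⟩
  -- The sets `K i` are treated one by one; the graph neighborhood `O` keeps what has been
  -- achieved.
  have key : ∀ (s : Finset ↥(F ∩ f ⁻¹' A)) (O : Set (X × Y)), IsOpen O → (∀ x, (x, f x) ∈ O) →
      ∃ f' : C(X, Y), (∀ x, (x, f' x) ∈ O) ∧ EqOn f' f C ∧
        ∀ i ∈ s, ∀ x ∈ K i, x ∈ F → f' x ∉ A := by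
    classical
    intro s
    induction s using Finset.induction_on with
    | empty => exact fun O _ hfO => ⟨f, hfO, fun _ _ => rfl, by simp⟩
    | insert a s _ ih =>
      intro O hO hfO
      obtain ⟨f₁, hf₁O, hf₁C, hf₁s⟩ := ih
        (O ∩ ((K a ×ˢ univ)ᶜ ∪ Prod.snd ⁻¹' (c a).source))
        (hO.inter (((hK a).prod isClosed_univ).isOpen_compl.union
          ((c a).isOpen_source.preimage continuous_snd)))
        fun x => ⟨hfO x, (em (x ∈ K a)).elim (fun h => Or.inr (hfK a h))
          fun h => Or.inl fun h' => h h'.1⟩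
      have hf₁a : MapsTo f₁ (K a) (c a).source := fun x hx =>
        (hf₁O x).2.resolve_left fun h => h ⟨hx, mem_univ _⟩
      obtain ⟨f₂, hf₂O, hf₂C, hf₂a⟩ := (c a).exists_perturbation hF hC (hK a) (hKC a) f₁ hf₁a
        (O := O ∩ ⋂ i ∈ s, ((K i ∩ F) ×ˢ A)ᶜ)
        (hO.inter (isOpen_biInter_finset fun i _ =>
          (((hK i).inter hFc).prod hAc).isOpen_compl))
        fun x => ⟨(hf₁O x).1, mem_iInter₂.2 fun i hi hx => hf₁s i hi x hx.1.1 hx.1.2 hx.2⟩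
      refine ⟨f₂, fun x => (hf₂O x).1, hf₂C.trans hf₁C, fun i hi x hx hxF => ?_⟩
      rcases Finset.mem_insert.1 hi with rfl | hi
      · exact hf₂a x hx hxF
      · exact fun hxA => mem_iInter₂.1 (hf₂O x).2 i hi ⟨⟨hx, hxF⟩, hxA⟩
  obtain ⟨f', hf'O, hf'C, hf't⟩ := key t (((F ∩ (⋃ i ∈ t, interior (K i))ᶜ) ×ˢ A)ᶜ)
    ((hFc.inter (isOpen_biUnion fun _ _ => isOpen_interior).isClosed_compl).prod hAc).isOpen_compl
    fun x hx => hx.1.2 (ht ⟨hx.1.1, hx.2⟩)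
  refine ⟨f', hf'C, fun x hxF hxA => ?_⟩
  by_cases hx : x ∈ ⋃ i ∈ t, interior (K i)
  · obtain ⟨i, hi, hx⟩ := mem_iUnion₂.1 hx
    exact hf't i hi x (interior_subset hx) hxF hxA
  · exact hf'O x ⟨⟨hxF, hx⟩, hxA⟩

end GeneralPosition

/-! ### Approximation by maps without zeros -/

theorem exists_nonvanishing_approx {V E : Type*} [NormedAddCommGroup V] [NormedSpace ℝ V]
    [FiniteDimensional ℝ V] [NormedAddCommGroup E] [NormedSpace ℝ E] [FiniteDimensional ℝ E]
    (hVE : Module.finrank ℝ V < Module.finrank ℝ E) (g : C(V, E)) {ε : ℝ} (hε : 0 < ε) :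
    ∃ h : C(V, E), (∀ x, ‖h x - g x‖ < ε) ∧ ∀ x, h x ≠ 0 := by
  obtain ⟨h, hh⟩ := exists_contMDiffMap_forall_mem_convex_of_local_const (n := 1)
    (modelWithCornersSelf ℝ V) (t := fun x => Metric.ball (g x) (ε / 2))
    (fun x => convex_ball _ _) fun x => ⟨g x, by
      filter_upwards [g.continuous.continuousAt (Metric.ball_mem_nhds (g x) (half_pos hε))]
        with y hy
      rwa [Metric.mem_ball']⟩
  obtain ⟨v, hv, hvε⟩ := (ContDiff.dense_compl_range_of_finrank_lt_finrank
    h.contMDiff.contDiff hVE).exists_dist_lt 0 (half_pos hε)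
  refine ⟨⟨fun x => h x - v, h.contMDiff.continuous.sub continuous_const⟩, fun x => ?_,
    fun x hx => hv ⟨x, sub_eq_zero.1 hx⟩⟩
  have h1 : ‖h x - g x‖ < ε / 2 := mem_ball_iff_norm.1 (hh x)
  have h2 : ‖v‖ < ε / 2 := by simpa using hvε
  calc ‖h x - v - g x‖ = ‖(h x - g x) - v‖ := by congr 1; abel
    _ ≤ ‖h x - g x‖ + ‖v‖ := norm_sub_le _ _
    _ < ε := by linarith

/-- The face `Q × {0}` of `Q × I` has dimension less than that of `E` if `Q` is a retract of a
normed space of dimension less than that of `E`. -/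
theorem nonvanishingDenseOn_zero_face {Q V E : Type*} [TopologicalSpace Q]
    [NormedAddCommGroup V] [NormedSpace ℝ V]
    [FiniteDimensional ℝ V] [NormedAddCommGroup E] [NormedSpace ℝ E] [FiniteDimensional ℝ E]
    (hVE : Module.finrank ℝ V < Module.finrank ℝ E) (e : C(Q, V)) (p : C(V, Q))
    (hpe : ∀ x, p (e x) = x) : NonvanishingDenseOn {x : Q × I | x.2 = 0} E := by
  intro g ε hε
  obtain ⟨h, hg, h0⟩ := exists_nonvanishing_approx hVE
    (g.comp ⟨fun v => (p v, 0), by fun_prop⟩) hε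
  -- The correction found on the face is used unchanged in the direction of `I`.
  refine ⟨⟨fun x => g x + (h (e x.1) - g (x.1, 0)), by fun_prop⟩, fun x => ?_, ?_⟩
  · simpa [hpe] using hg (e x.1)
  · rintro ⟨x, u⟩ (rfl : u = 0)
    simpa using h0 (e x)

/-- The coordinatewise retraction of `ℝ × ℝⁱ` onto the cube `I × Iⁱ`. -/
noncomputable def realToCube (i : ℕ) : C(ℝ × (Fin i → ℝ), I × (Fin i → I)) where
  toFun v := (projIcc 0 1 zero_le_one v.1, fun j => projIcc 0 1 zero_le_one (v.2 j))

/-- The inclusion of the cube `I × Iⁱ` into `ℝ × ℝⁱ`. -/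
noncomputable def cubeToReal (i : ℕ) : C(I × (Fin i → I), ℝ × (Fin i → ℝ)) where
  toFun v := (v.1, fun j => v.2 j)

theorem realToCube_cubeToReal (i : ℕ) (x) : realToCube i (cubeToReal i x) = x := by
  simp [realToCube, cubeToReal]

/-! ### Contracting cubical loops of paths with a fixed end point -/

/-- The space of paths in `Y` that end at `y`, as a subspace of `C(I, Y)`. -/
abbrev PathsEndingAt {Y : Type*} [TopologicalSpace Y] (y : Y) : Type _ :=
  {γ : C(I, Y) // γ 1 = y}

section PathsEndingAt

variable {Y : Type*} [TopologicalSpace Y] {y : Y}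

/-- The path `γ` with its part before time `t` replaced by the constant path at `γ t`. This
contracts the space of paths ending at `y` to the constant path at `y` as `t` runs from `0` to `1`. -/
noncomputable def delay : C(I × PathsEndingAt y, PathsEndingAt y) where
  toFun p := ⟨p.2.1.comp ⟨fun u => max u p.1, by fun_prop⟩, by
    change p.2.1 (max 1 p.1) = y
    rw [max_eq_left unitInterval.le_one', p.2.2]⟩
  continuous_toFun := by
    refine Continuous.subtype_mk (ContinuousMap.continuous_of_continuous_uncurry _ ?_) _
    change Continuous fun q : (I × PathsEndingAt y) × I => q.1.2.1 (max q.2 q.1.1)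
    fun_prop

theorem delay_zero (γ : PathsEndingAt y) : delay (0, γ) = γ := by
  ext u; simp [delay]

theorem delay_one (γ γ' : PathsEndingAt y) : delay (1, γ) = delay (1, γ') := by
  ext u
  change γ.1 (max u 1) = γ'.1 (max u 1)
  rw [max_eq_right unitInterval.le_one', γ.2, γ'.2]

/-- The dilation of the cube from its center by the factor `1 + t`, clamped to the cube. -/
noncomputable def dilate (i : ℕ) : C(I × (Fin i → I), Fin i → I) where
  toFun p j := projIcc 0 1 zero_le_one ((1 + p.1 : ℝ) * (p.2 j) - p.1 / 2)

/-- A function on the cube which vanishes on the boundary and is `1` on `[1/4, 3/4]ⁱ`. -/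
noncomputable def bump (i : ℕ) : C(Fin i → I, I) where
  toFun s := ∏ j, projIcc 0 1 zero_le_one (4 * min (s j : ℝ) (1 - s j))

theorem dilate_zero {i : ℕ} (s : Fin i → I) : dilate i (0, s) = s := by
  ext j; simp [dilate]

theorem dilate_mem_boundary {i : ℕ} (t : I) {s : Fin i → I} (hs : s ∈ Cube.boundary (Fin i)) :
    dilate i (t, s) ∈ Cube.boundary (Fin i) := by
  obtain ⟨j, hj⟩ := hs
  have := t.2.1
  refine ⟨j, hj.imp (fun h => ?_) fun h => ?_⟩
  · exact projIcc_of_le_left zero_le_one (by simp only [h, Icc.coe_zero]; linarith)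
  · exact projIcc_of_right_le zero_le_one (by simp only [h, Icc.coe_one]; linarith)

theorem bump_of_mem_boundary {i : ℕ} {s : Fin i → I} (hs : s ∈ Cube.boundary (Fin i)) :
    bump i s = 0 := by
  obtain ⟨j, hj⟩ := hs
  refine Finset.prod_eq_zero (Finset.mem_univ j) (projIcc_of_le_left zero_le_one ?_)
  rcases hj with h | h <;> simp [h]

/-- The dilation by the factor `2` sends everything outside `(1/4, 3/4)ⁱ` to the boundary. -/
theorem dilate_one_mem_boundary_or {i : ℕ} (s : Fin i → I) :
    dilate i (1, s) ∈ Cube.boundary (Fin i) ∨ bump i s = 1 := by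
  refine or_iff_not_imp_left.2 fun h => (Finset.prod_eq_one fun j _ => ?_ :
    ∏ j, projIcc 0 1 zero_le_one (4 * min (s j : ℝ) (1 - s j)) = 1)
  refine projIcc_of_right_le zero_le_one ?_
  by_contra! hlt
  refine h ⟨j, ?_⟩
  rcases min_lt_iff.1 (show min (s j : ℝ) (1 - s j) < 1 / 4 by linarith) with hj | hj
  · exact Or.inl (projIcc_of_le_left zero_le_one (by simp only [Icc.coe_one]; linarith))
  · exact Or.inr (projIcc_of_right_le zero_le_one (by simp only [Icc.coe_one]; linarith))

/-- The space of paths ending at `y` has trivial homotopy groups at every base point `γ`. The plain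
contraction moves the boundary of the cube; so the loop is first dilated to be `γ` on a collar, the
paths in the interior being delayed until they are constant, and the resulting family
`delay (bump s, γ)` depends on `γ` alone and is undelayed. -/
theorem homotopicRel_const_of_pathsEndingAt {i : ℕ} (ℓ : C(Fin i → I, PathsEndingAt y))
    (γ : PathsEndingAt y) (hℓ : ∀ s ∈ Cube.boundary (Fin i), ℓ s = γ) :
    ℓ.HomotopicRel (ContinuousMap.const _ γ) (Cube.boundary (Fin i)) := by
  let m : C(Fin i → I, PathsEndingAt y) := ⟨fun s => delay (bump i s, γ), by fun_prop⟩
  have h₁ : ℓ.HomotopicRel m (Cube.boundary (Fin i)) := ⟨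
    { toFun := fun p => delay (p.1 * bump i p.2, ℓ (dilate i p))
      map_zero_left := fun s => by simp [delay_zero, dilate_zero]
      map_one_left := fun s => by
        rcases dilate_one_mem_boundary_or s with h | h
        · simp [m, hℓ _ h]
        · simpa [m, h] using delay_one _ _
      prop' := fun t s hs => by
        simp [bump_of_mem_boundary hs, delay_zero, hℓ s hs, hℓ _ (dilate_mem_boundary t hs)] }⟩
  have h₂ : (ContinuousMap.const _ γ).HomotopicRel m (Cube.boundary (Fin i)) := ⟨
    { toFun := fun p => delay (p.1 * bump i p.2, γ)
      map_zero_left := fun s => by simp [delay_zero]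
      map_one_left := fun s => by simp [m]
      prop' := fun t s hs => by simp [bump_of_mem_boundary hs, delay_zero] }⟩
  exact h₁.trans h₂.symm

end PathsEndingAt

/-! ### The homotopy fiber of the inclusion of a complement -/

theorem isClosed_cube_boundary (i : ℕ) : IsClosed (Cube.boundary (Fin i)) := by
  simp only [Cube.boundary, ofPred_exists]
  exact isClosed_iUnion_of_finite fun j =>
    (isClosed_eq (continuous_apply j) continuous_const).union
      (isClosed_eq (continuous_apply j) continuous_const)

/-- The inclusion of the complement of `A`. -/
def complInclusion {Y : Type*} [TopologicalSpace Y] (A : Set Y) : C((Aᶜ : Set Y), Y) :=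
  ⟨Subtype.val, continuous_subtype_val⟩

section HomotopyFiber

variable {Y E : Type*} [TopologicalSpace Y] [NormedAddCommGroup E] [NormedSpace ℝ E]
  [FiniteDimensional ℝ E] {A : Set Y}

/-- The constant path at `y` can be changed so as to start outside `A`. -/
theorem HasTransverseCharts.nonempty_homotopyFiber (hA : HasTransverseCharts A E)
    (hAc : IsClosed A) (hE : 0 < Module.finrank ℝ E) (y : Y) :
    Nonempty (HomotopyFiber (complInclusion A) y) := by
  have hF : NonvanishingDenseOn {x : Unit × I | x.2 = 0} E :=
    nonvanishingDenseOn_zero_face (V := Fin 0 → ℝ) (by simpa using hE)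
      (ContinuousMap.const _ 0) (ContinuousMap.const _ ()) fun _ => rfl
  obtain ⟨f, hfC, hfA⟩ := hA.exists_avoiding hAc hF
    (isClosed_eq continuous_snd continuous_const)
    (isClosed_eq continuous_snd continuous_const : IsClosed {x : Unit × I | x.2 = 1})
    (ContinuousMap.const _ y) fun x h0 h1 => absurd (h0.symm.trans h1) zero_ne_one
  exact ⟨⟨(⟨f ((), 0), hfA _ rfl⟩, f.comp ⟨fun u => ((), u), by fun_prop⟩), rfl, hfC rfl⟩⟩

/-- The uncurried null-homotopy `(I × Iⁱ) × I → Y` of a loop of paths is pushed off `A` on the face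
of starting points, relative to all other faces. -/
theorem HasTransverseCharts.subsingleton_pi_homotopyFiber (hA : HasTransverseCharts A E)
    (hAc : IsClosed A) {i : ℕ} (hi : i + 1 < Module.finrank ℝ E) (y : Y)
    (x : HomotopyFiber (complInclusion A) y) :
    Subsingleton (HomotopyGroup.Pi i _ x) := by
  suffices h : ∀ ℓ : GenLoop (Fin i) _ x, GenLoop.Homotopic ℓ GenLoop.const by
    refine ⟨fun a b => ?_⟩
    induction a using Quotient.inductionOn with | _ a => ?_
    induction b using Quotient.inductionOn with | _ b => ?_
    exact Quotient.sound ((h a).trans (h b).symm)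
  intro ℓ
  let ℓ' : C(Fin i → I, PathsEndingAt y) :=
    ⟨fun s => ⟨(ℓ s).1.2, (ℓ s).2.2⟩, by
      refine Continuous.subtype_mk (continuous_snd.comp (continuous_subtype_val.comp ?_)) _
      exact ℓ.1.continuous⟩
  obtain ⟨H⟩ := homotopicRel_const_of_pathsEndingAt ℓ' ⟨x.1.2, x.2.2⟩ fun s hs =>
    Subtype.ext (congrArg (fun z => z.1.2) (ℓ.2 s hs))
  -- The face of starting points of the paths.
  have hF : NonvanishingDenseOn {q : (I × (Fin i → I)) × I | q.2 = 0} E :=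
    nonvanishingDenseOn_zero_face (V := ℝ × (Fin i → ℝ)) (by simpa [add_comm] using hi)
      (cubeToReal i) (realToCube i) (realToCube_cubeToReal i)
  -- The union of all other faces, on which the homotopy must not change.
  have hC : IsClosed {q : (I × (Fin i → I)) × I |
      q.1.1 = 0 ∨ q.1.1 = 1 ∨ q.1.2 ∈ Cube.boundary (Fin i) ∨ q.2 = 1} :=
    (isClosed_eq (by fun_prop) (by fun_prop)).union <|
      (isClosed_eq (by fun_prop) (by fun_prop)).union <|
      ((isClosed_cube_boundary i).preimage (by fun_prop)).union
        (isClosed_eq (by fun_prop) (by fun_prop))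
  have hH : ∀ t, ∀ s ∈ Cube.boundary (Fin i), (H (t, s)).1 = x.1.2 := fun t s hs =>
    congrArg Subtype.val (H.eq_snd t hs)
  obtain ⟨f, hfC, hfA⟩ := hA.exists_avoiding hAc hF
    (isClosed_eq continuous_snd continuous_const) hC
    ⟨fun q => (H q.1).1 q.2, by fun_prop⟩ (by
      rintro ⟨⟨t, s⟩, u⟩ (rfl : u = 0) (rfl | rfl | hs | h1)
      · have h : (H (0, s)).1 0 = (ℓ s).1.1 := by
          rw [H.apply_zero]; exact (ℓ s).2.1
        change (H (0, s)).1 0 ∉ A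
        rw [h]; exact (ℓ s).1.1.2
      · have h : (H (1, s)).1 0 = x.1.1 := by
          rw [H.apply_one]; exact x.2.1
        change (H (1, s)).1 0 ∉ A
        rw [h]; exact x.1.1.2
      · have h : (H (t, s)).1 0 = x.1.1 := by
          rw [hH t s hs]; exact x.2.1
        change (H (t, s)).1 0 ∉ A
        rw [h]; exact x.1.1.2
      · exact absurd h1 zero_ne_one)
  -- A point of the homotopy fiber is determined by its path.
  have hext : ∀ (q : I × (Fin i → I)) (z : HomotopyFiber (complInclusion A) y)
      (hq : ∀ u, f (q, u) = z.1.2 u),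
      (⟨(⟨f (q, 0), hfA _ rfl⟩, f.curry q), rfl,
        (hfC (Or.inr (Or.inr (Or.inr rfl)))).trans (H q).2⟩ :
          HomotopyFiber (complInclusion A) y) = z := fun q z hq =>
    Subtype.ext (Prod.ext (Subtype.ext ((hq 0).trans z.2.1)) (ContinuousMap.ext hq))
  refine ⟨{ toFun := fun q => ⟨(⟨f (q, 0), hfA _ rfl⟩, f.curry q), rfl,
      (hfC (Or.inr (Or.inr (Or.inr rfl)))).trans (H q).2⟩
            continuous_toFun := by fun_prop
            map_zero_left := fun s => hext _ _ fun u => ?_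
            map_one_left := fun s => hext _ _ fun u => ?_
            prop' := fun t s hs => (hext (t, s) x fun u => ?_).trans (ℓ.2 s hs).symm }⟩
  · refine (hfC (Or.inl rfl)).trans ?_
    exact congrArg (fun γ => γ.1 u) (H.apply_zero s)
  · refine (hfC (Or.inr (Or.inl rfl))).trans ?_
    exact congrArg (fun γ => γ.1 u) (H.apply_one s)
  · refine (hfC (Or.inr (Or.inr (Or.inl hs)))).trans ?_
    exact DFunLike.congr_fun (hH t s hs) u

theorem HasTransverseCharts.isKConnectedMap_compl_inclusion (hA : HasTransverseCharts A E)
    (hAc : IsClosed A) :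
    IsKConnectedMap (Module.finrank ℝ E - 1) (complInclusion A) := fun y =>
  ⟨fun h => hA.nonempty_homotopyFiber hAc (by omega) y,
    fun i hi x => hA.subsingleton_pi_homotopyFiber hAc (by omega) y x⟩

end HomotopyFiber

/-! ### The thin diagonal -/

theorem mainTheorem10 (n r : ℕ) (N : Type*) [TopologicalSpace N] [T2Space N]
    [ChartedSpace (EuclideanSpace ℝ (Fin n)) N] :
    IsKConnectedMap (((r : ℤ) - 1) * (n : ℤ) - 1) (thinDiagonalComplInclusion r N) := by
  cases r with
  -- Here the claim is `(-n - 1)`-connectedness, which is void.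
  | zero =>
    exact fun y => ⟨fun h => by push_cast at h; omega, fun i hi => by push_cast at hi; omega⟩
  | succ k =>
    have h := (hasTransverseCharts_thinDiagonal k (EuclideanSpace ℝ (Fin n)) N
      ).isKConnectedMap_compl_inclusion (isClosed_thinDiagonal (k + 1) N)
    simpa [Module.finrank_pi_fintype, thinDiagonalComplInclusion, complInclusion] using h
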